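/- **Setting.** Let $\mathbb F$ be a finite field with $q$ elements, let $r_1,r_2,t$ be natural numbers with $\gcd(q,r_1r_2)=1$ and $t\le\lfloor r_i/2\rfloor$ for $i=1,2$, and let $\mathbb L\supseteq\mathbb F$ be a field extension with elements $\alpha_1,\alpha_2\in\mathbb L$ such that $\alpha_i^{r_i}=1$. Let $e=\sum_m e_m\mathbf X^m\in\mathbb F[X_1,X_2]$ have all its exponents in $\{0,\dots,r_1-1\}\times\{0,\dots,r_2-1\}$ and at most $t$ nonzero coefficients, and let $\tau\in\{0,\dots,r_1-1\}\times\{0,\dots,r_2-1\}$. Let $U=(u_n)_{n\in\mathbb N\times\mathbb N}$ be the syndrome table $u_n=e(\alpha_1^{\tau_1+n_1},\alpha_2^{\tau_2+n_2})$. Write $\preceq$ for the coordinatewise order on $\mathbb N\times\mathbb N$, and let $\le_T$ be one of two monomial orders: the lexicographic order with $X_1>X_2$, or the graded order with $X_2>X_1$ (compare total degrees; for equal total degree the larger exponent of $X_2$ is larger). Assume that $u_{(0,j)}\ne0$ for some $j<t$ if $\le_T$ is lexicographic, and that $u_{(i,j)}\neq 0$ for some $(i,j)$ with $i+j=1$ if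 $\le_T$ is graded. For $0\ne f=\sum_m f_m\mathbf X^m\in\mathbb L[X_1,X_2]$ let $LP(f)$ be the leading exponent of $f$ for $\le_T$; put $f[U]_n=\sum_m f_m\,u_{m+n-LP(f)}$ if $LP(f)\preceq n$, and $f[U]_n=0$ otherwise. For an index $l$, let $\mathbf\Lambda(u^l)$ be the set of those $f$ with $f[U]_k=0$ for all $k$ with $LP(f)\preceq k$ and $k<_Tl$. A set $F_l=\{f^{(1)},\dots,f^{(d)}\}$ of nonzero elements of $\mathbf\Lambda(u^l)$, with $s^{(i)}=(s^{(i)}_1,s^{(i)}_2)=LP(f^{(i)})$, is a *minimal set of polynomials* for $u^l$ if $s^{(1)}_1>\dots>s^{(d)}_1=0$ and $0=s^{(1)}_2<\dots<s^{(d)}_2$, and no nonzero $g$ with $LP(g)\preceq(s_1^{(i)}-1,s_2^{(i+1)}-1)$ for some $1\le i\le d-1$ lies in $\mathbf\Lambda(u^l)$. (The sets $F_l$ constructed by the Berlekamp–Massey–Sakata algorithm are minimal sets for $u^l$.) **Theorem.** 1. Let $t\ge2$, $l=(1,t-1)$, and let $F_l=\{f^{(1)},\dots,f^{(d)}\}$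 be a minimal set of polynomials for $u^l$. Then there exists $f\in F_l$ with $LP(f)\preceq l$ and $f[U]_l=0$, except in the following cases: - (a) $d=2$, $s^{(1)}_1=1$, $s^{(2)}_2=t$, and either $\le_T$ is the lexicographic order, or $\le_T$ is the graded order, $t=2$ and $u_{(0,0)}=u_{(1,0)}=0$; - (b) $d=2$, $s^{(1)}=(2,0)$, $t=2s^{(2)}_2$, where moreover $l\ne(1,1)$ if $\le_T$ is the lexicographic order; - (c) $d=3$, $s^{(1)}=(2,0)$, $t=s^{(2)}_2+s^{(3)}_2$. 2. Let $t>2$, $l=(t-1,1)$, and let $F_l=\{f^{(1)},\dots,f^{(d)}\}$ be a minimal set of polynomials for $u^l$. Then there exists $f\in F_l$ with $LP(f)\preceq l$ and $f[U]_l=0$, except in the following cases: - (a) $d=2$, $s^{(1)}_1=t$, $s^{(2)}_2=1$, and $\le_T$ is the graded order; - (b) $d=2$, $s^{(2)}=(0,2)$, $t=2s^{(1)}_1$; - (c) $d=3$, $s^{(3)}=(0,2)$, $t=s^{(1)}_1+s^{(2)}_1$. -/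

import Mathlib

open MvPolynomial

noncomputable section

/-- Indices of arrays and exponents of monomials in two variables: pairs of natural numbers.
The partial order `n ⪯ m` (coordinatewise) is the order `≤` of this type. Coordinate `0` belongs
to the variable `X₁` and coordinate `1` to the variable `X₂`. -/
abbrev Idx : Type := Fin 2 →₀ ℕ

/-- The pair `(a, b)`. -/
def idx (a b : ℕ) : Idx := Finsupp.single 0 a + Finsupp.single 1 b

/-- Exchange of the two coordinates. -/
def swapIdx : Idx ≃+ Idx := Finsupp.domCongr (Equiv.swap (0 : Fin 2) 1)

/-- The graded order with `X₂ > X₁`: first compare the total degrees, then the exponents of `X₂`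
(for equal total degrees the greater exponent of `X₂` is the greater one). -/
def gradedOrder : MonomialOrder (Fin 2) where
  syn := (MonomialOrder.degLex (σ := Fin 2)).syn
  toSyn := swapIdx.trans (MonomialOrder.degLex (σ := Fin 2)).toSyn
  toSyn_monotone := by
    intro a b h
    apply (MonomialOrder.degLex (σ := Fin 2)).toSyn_monotone
    intro i
    exact h _

/-- The two monomial orders under which the algorithm is run: the lexicographic order with
`X₁ > X₂`, and the graded order with `X₂ > X₁`. -/
inductive TermOrder : Type
  | lex : TermOrder
  | graded : TermOrder

/-- The monomial order itself. -/
def TermOrder.order : TermOrder → MonomialOrder (Fin 2)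
  | TermOrder.lex => MonomialOrder.lex
  | TermOrder.graded => gradedOrder

/-- The strict order `m <_T n` on indices. -/
def TermOrder.lt (T : TermOrder) (m n : Idx) : Prop := T.order.toSyn m < T.order.toSyn n

section Recurrences

variable {L : Type*} [Field L]

/-- The leading power product exponent (multidegree) of `f`. -/
def LP (T : TermOrder) (f : MvPolynomial (Fin 2) L) : Idx := T.order.degree f

/-- The value `f[U]_n`. It is `0` by convention if `LP f ⪯ n` fails. -/
def recVal (T : TermOrder) (u : Idx → L) (f : MvPolynomial (Fin 2) L) (n : Idx) : L :=
  open scoped Classical in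
  if LP T f ≤ n then ∑ m ∈ f.support, f.coeff m * u (m + (n - LP T f)) else 0

/-- `f` generates the finite subarray `u^l`, that is, `f ∈ Λ(u^l)`. -/
def Generates (T : TermOrder) (u : Idx → L) (l : Idx) (f : MvPolynomial (Fin 2) L) : Prop :=
  ∀ k : Idx, LP T f ≤ k → T.lt k l → recVal T u f k = 0

/-- The footprint determined by the defining points `s 1, …, s d`: all `n` with
`n ⪯ (s i 0 - 1, s (i + 1) 1 - 1)` (subtraction in the integers) for some `1 ≤ i ≤ d - 1`. -/
def footprint (d : ℕ) (s : ℕ → Idx) : Set Idx :=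
  {n | ∃ i, 1 ≤ i ∧ i < d ∧ n 0 < s i 0 ∧ n 1 < s (i + 1) 1}

/-- `f 1, …, f d` is a minimal set of polynomials for `u^l`
(the values of `f` outside `{1, …, d}` play no role). -/
structure IsMinimalSet (T : TermOrder) (u : Idx → L) (l : Idx) (d : ℕ)
    (f : ℕ → MvPolynomial (Fin 2) L) : Prop where
  one_le : 1 ≤ d
  ne_zero : ∀ i, 1 ≤ i → i ≤ d → f i ≠ 0
  generates : ∀ i, 1 ≤ i → i ≤ d → Generates T u l (f i)
  fst_anti : ∀ i, 1 ≤ i → i < d → LP T (f (i + 1)) 0 < LP T (f i) 0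
  fst_last : LP T (f d) 0 = 0
  snd_first : LP T (f 1) 1 = 0
  snd_mono : ∀ i, 1 ≤ i → i < d → LP T (f i) 1 < LP T (f (i + 1)) 1
  minimal : ∀ g : MvPolynomial (Fin 2) L, g ≠ 0 →
    LP T g ∈ footprint d (fun i => LP T (f i)) → ¬ Generates T u l g

/-- The condition on the initial values: under the lexicographic order, `u_(0,j) ≠ 0` for some
`j < t`; under the graded order, `u_(i,j) ≠ 0` for some `(i,j)` with `i + j = 1`. -/
def InitialCondition (T : TermOrder) (t : ℕ) (u : Idx → L) : Prop :=
  match T with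
  | TermOrder.lex => ∃ j, j < t ∧ u (idx 0 j) ≠ 0
  | TermOrder.graded => ∃ i j, i + j = 1 ∧ u (idx i j) ≠ 0

end Recurrences

/-- `e` is the canonical representative of an element of
`F[X₁, X₂] / (X₁ ^ r₁ - 1, X₂ ^ r₂ - 1)`. -/
def IsCanonical {F : Type*} [Field F] (r₁ r₂ : ℕ) (e : MvPolynomial (Fin 2) F) : Prop :=
  ∀ m ∈ e.support, m 0 < r₁ ∧ m 1 < r₂

/-- The syndrome table afforded by `τ` and `e`: `u_n = e(α₁ ^ (τ₁ + n₁), α₂ ^ (τ₂ + n₂))`. -/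
def syndromeTable {F L : Type*} [Field F] [Field L] [Algebra F L] (α₁ α₂ : L) (τ : Idx)
    (e : MvPolynomial (Fin 2) F) : Idx → L :=
  fun n => aeval ![α₁ ^ (τ 0 + n 0), α₂ ^ (τ 1 + n 1)] e

end

/-!
Let `Δ` (`deltaSet`) be the footprint of the ideal of the linear recurrences valid on the whole
table `U`. Since `U` is a sum of at most `t` products of geometric progressions, one for each term
of `e`, the set `Δ` has at most `t` elements (`card_le_of_subset_deltaSet`).

Suppose that no `f ∈ F_l` with `LP f ⪯ l` satisfies `f[U]_l = 0`. Then `l - LP f ∈ Δ` for each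
`f ∈ F_l` with `LP f ⪯ l`, by Sakata's argument (`sub_mem_deltaSet`), and the footprint of `F_l`
lies in `Δ` by minimality. Each point `p ⪯ l` lies either in the footprint of `F_l` or above some
`LP f`, so `p ∈ Δ` or `l - p ∈ Δ`. The rectangle below `l` has exactly `2t` points, hence `Δ`
consists of `t` points of that rectangle and contains exactly one point of each pair `p`, `l - p`
(`IsMinimalSet.reflectedStaircase`).

As the rectangle has width two, few staircases are possible
(`ReflectedStaircase.classification`): besides the exceptional shapes of the theorem, only the
empty footprint, which would force `U` to vanish before `l`. The case `l = (t - 1, 1)` follows from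
`l = (1, t - 1)` by exchanging the coordinates. The conditions on the order and on the initial
values in the exceptional cases come from minimality: where a single index tests the polynomials
with leading exponent `m`, there is such a polynomial in `Λ(u^l)` unless `U` vanishes before `m`
(`eq_zero_of_forall_not_generates`).
-/

/-! ### Coordinates and the two monomial orders -/

@[simp] lemma idx_apply_zero (a b : ℕ) : idx a b 0 = a := by simp [idx]

@[simp] lemma idx_apply_one (a b : ℕ) : idx a b 1 = b := by simp [idx]

lemma idx_eta (n : Idx) : idx (n 0) (n 1) = n := by
  ext i; fin_cases i <;> simp

lemma le_iff_coords {m n : Idx} : m ≤ n ↔ m 0 ≤ n 0 ∧ m 1 ≤ n 1 := by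
  rw [Finsupp.le_def, Fin.forall_fin_two]

lemma idx_sub (a b a' b' : ℕ) : idx a b - idx a' b' = idx (a - a') (b - b') := by
  ext i; fin_cases i <;> simp

lemma lex_lt_coords {m n : Idx} :
    TermOrder.lex.lt m n ↔ m 0 < n 0 ∨ m 0 = n 0 ∧ m 1 < n 1 := by
  change MonomialOrder.lex.toSyn m < MonomialOrder.lex.toSyn n ↔ _
  rw [MonomialOrder.lex_lt_iff, Finsupp.Lex.lt_iff]
  simp [Fin.exists_fin_two]

lemma graded_lt_coords {m n : Idx} :
    TermOrder.graded.lt m n ↔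
      m 0 + m 1 < n 0 + n 1 ∨ m 0 + m 1 = n 0 + n 1 ∧ m 1 < n 1 := by
  change MonomialOrder.degLex.toSyn (swapIdx m) < MonomialOrder.degLex.toSyn (swapIdx n) ↔ _
  have h0 (k : Idx) : swapIdx k 0 = k 1 := by simp [swapIdx]
  have h1 (k : Idx) : swapIdx k 1 = k 0 := by simp [swapIdx]
  rw [MonomialOrder.degLex_lt_iff, Finsupp.DegLex.lt_iff, Finsupp.Lex.lt_iff]
  simp only [Finsupp.degree_eq_sum, Fin.sum_univ_two, Fin.exists_fin_two, ofDegLex_toDegLex,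
    ofLex_toLex, h0, h1]
  have (j : Fin 2) : ¬ j < 0 := by simp
  simp only [this, Fin.forall_fin_two, h0, h1]
  simp
  omega

lemma TermOrder.lt_irrefl (T : TermOrder) (m : Idx) : ¬ T.lt m m :=
  _root_.lt_irrefl (T.order.toSyn m)

lemma TermOrder.lt_or_eq_of_le {T : TermOrder} {m n : Idx}
    (h : T.order.toSyn m ≤ T.order.toSyn n) : T.lt m n ∨ m = n :=
  h.lt_or_eq.imp id fun h' => T.order.toSyn.injective h'

lemma TermOrder.add_lt_add_right {T : TermOrder} {m n : Idx} (h : T.lt m n) (k : Idx) :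
    T.lt (m + k) (n + k) := by
  change T.order.toSyn (m + k) < T.order.toSyn (n + k)
  rw [map_add, map_add]
  exact add_lt_add_left h _

section Pairing

variable {L : Type*} [Field L]

/-! ### Recurrences valid on the whole table -/

/-- The value at `n` of the table `u` to which the polynomial `f` has been applied as a shift
operator. In contrast to `recVal`, the table is not displaced by the leading exponent of `f`. -/
noncomputable def shiftVal (u : Idx → L) (f : MvPolynomial (Fin 2) L) (n : Idx) : L :=
  ∑ m ∈ f.support, f.coeff m * u (m + n)

/-- `g` is a linear recurrence relation valid on the whole infinite table `u`. -/
def Annihilates (u : Idx → L) (g : MvPolynomial (Fin 2) L) : Prop :=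
  ∀ n, shiftVal u g n = 0

/-- The footprint of the ideal of all recurrences of `u`: the exponents that are not divisible by
the leading exponent of any nonzero recurrence. -/
def deltaSet (T : TermOrder) (u : Idx → L) : Set Idx :=
  {n | ∀ g : MvPolynomial (Fin 2) L, g ≠ 0 → Annihilates u g → ¬ LP T g ≤ n}

variable {T : TermOrder} {u : Idx → L} {l : Idx}

lemma recVal_eq_shiftVal {f : MvPolynomial (Fin 2) L} {n : Idx} (h : LP T f ≤ n) :
    recVal T u f n = shiftVal u f (n - LP T f) := by
  simp [recVal, shiftVal, h]

lemma Annihilates.generates {g : MvPolynomial (Fin 2) L} (h : Annihilates u g) :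
    Generates T u l g :=
  fun k hk _ => by rw [recVal_eq_shiftVal hk, h]

lemma mem_deltaSet_of_le {m n : Idx} (h : m ≤ n) (hn : n ∈ deltaSet T u) : m ∈ deltaSet T u :=
  fun g hg ha hm => hn g hg ha (hm.trans h)

/-- If `f` fails for the first time at `l`, then the double sum
`∑ f_m g_k u_{m + k + l - LP f - LP g}` vanishes when it is summed along a global recurrence `g`,
whereas summation along `f` leaves only the term of the leading exponent of `g`, which is
nonzero. -/
lemma sub_mem_deltaSet {f : MvPolynomial (Fin 2) L} (hf : Generates T u l f)
    (hfl : LP T f ≤ l) (hne : recVal T u f l ≠ 0) : l - LP T f ∈ deltaSet T u := by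
  intro g hg ha hle
  set c := l - LP T f - LP T g with hc
  have hl : LP T f + (LP T g + c) = l := by
    rw [hc, add_tsub_cancel_of_le hle, add_tsub_cancel_of_le hfl]
  have hswap : ∑ k ∈ g.support, g.coeff k * shiftVal u f (k + c) =
      ∑ m ∈ f.support, f.coeff m * shiftVal u g (m + c) := by
    simp only [shiftVal, Finset.mul_sum]
    rw [Finset.sum_comm]
    refine Finset.sum_congr rfl fun m _ => Finset.sum_congr rfl fun k _ => ?_
    rw [add_left_comm k m c]
    ring
  have hzero : ∑ m ∈ f.support, f.coeff m * shiftVal u g (m + c) = 0 :=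
    Finset.sum_eq_zero fun m _ => by rw [ha, mul_zero]
  have hsingle : ∑ k ∈ g.support, g.coeff k * shiftVal u f (k + c) =
      g.coeff (LP T g) * shiftVal u f (LP T g + c) := by
    refine Finset.sum_eq_single _ (fun k hk hkne => ?_) fun h => ?_
    · have hlt : T.lt k (LP T g) :=
        (TermOrder.lt_or_eq_of_le (T.order.le_degree hk)).resolve_right hkne
      have h0 := hf (LP T f + (k + c)) le_self_add (by
        rw [← hl, add_comm (LP T f), add_comm (LP T f)]
        exact TermOrder.add_lt_add_right (TermOrder.add_lt_add_right hlt c) _)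
      rw [recVal_eq_shiftVal le_self_add, add_tsub_cancel_left] at h0
      rw [h0, mul_zero]
    · rw [notMem_support_iff.mp h, zero_mul]
  rw [recVal_eq_shiftVal hfl, ← hl, add_tsub_cancel_left] at hne
  rw [hswap, hzero] at hsingle
  exact mul_ne_zero (T.order.coeff_degree_ne_zero_iff.mpr hg) hne hsingle.symm

/-- A table afforded by the points `(x p, y p)`, `p ∈ E`, has at most `#E` exponents in its
footprint: among more than `#E` monomials, some combination vanishes at all the points. -/
lemma card_le_of_subset_deltaSet {ι : Type*} (E : Finset ι) (c x y : ι → L)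
    (hu : ∀ n, u n = ∑ p ∈ E, c p * x p ^ n 0 * y p ^ n 1) (S : Finset Idx)
    (hS : ∀ n ∈ S, n ∈ deltaSet T u) : S.card ≤ E.card := by
  by_contra! hlt
  let A : Matrix E S L := fun p m => x p ^ m.1 0 * y p ^ m.1 1
  have hker : A.mulVecLin.ker ≠ ⊥ := by
    apply LinearMap.ker_ne_bot_of_finrank_lt
    simpa using hlt
  obtain ⟨v, hv, hv0⟩ := (Submodule.ne_bot_iff _).mp hker
  let g : MvPolynomial (Fin 2) L := ∑ m : S, monomial m.1 (v m)
  have hcoeff (m : S) : g.coeff m.1 = v m := by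
    simp only [g, coeff_sum, coeff_monomial, Subtype.val_inj]
    simp
  have hsupp : g.support ⊆ S := by
    intro n hn
    by_contra hnS
    refine mem_support_iff.mp hn ?_
    simp only [g, coeff_sum, coeff_monomial]
    exact Finset.sum_eq_zero fun m _ => if_neg fun h : m.1 = n => hnS (h ▸ m.2)
  have hg : g ≠ 0 := by
    rintro h0
    exact hv0 (funext fun m => by rw [← hcoeff, h0]; simp)
  have hvan (p : ι) (hp : p ∈ E) : ∑ m ∈ S, g.coeff m * (x p ^ m 0 * y p ^ m 1) = 0 := by
    have := congrFun (LinearMap.mem_ker.mp hv) ⟨p, hp⟩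
    rw [Matrix.mulVecLin_apply, Matrix.mulVec, dotProduct] at this
    rw [← Finset.sum_coe_sort]
    simpa [A, hcoeff, mul_comm] using this
  refine hS _ (hsupp (T.order.degree_mem_support hg)) g hg (fun n => ?_) le_rfl
  have hext : shiftVal u g n = ∑ m ∈ S, g.coeff m * u (m + n) :=
    Finset.sum_subset hsupp fun m _ hm => by rw [notMem_support_iff.mp hm, zero_mul]
  have hterm : ∀ m ∈ S, g.coeff m * u (m + n) = ∑ p ∈ E,
      c p * x p ^ n 0 * y p ^ n 1 * (g.coeff m * (x p ^ m 0 * y p ^ m 1)) := by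
    intro m _
    rw [hu, Finset.mul_sum]
    refine Finset.sum_congr rfl fun p _ => ?_
    simp only [Finsupp.add_apply, pow_add]
    ring
  rw [hext, Finset.sum_congr rfl hterm, Finset.sum_comm]
  refine Finset.sum_eq_zero fun p hp => ?_
  rw [← Finset.mul_sum, hvan p hp, mul_zero]

/-! ### Small tables -/

/-- If `m` is the only index at which a polynomial with leading exponent `m` is tested, and `u`
does not vanish at some `k <_T m`, then a multiple of the monomial of exponent `k` corrects the
value of the monomial of exponent `m`. -/
lemma eq_zero_of_forall_not_generates {m : Idx}
    (honly : ∀ k, m ≤ k → T.lt k l → k = m)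
    (hno : ∀ g : MvPolynomial (Fin 2) L, g ≠ 0 → LP T g = m → ¬ Generates T u l g)
    {k : Idx} (hk : T.lt k m) : u k = 0 := by
  classical
  by_contra hne
  have hkm : k ≠ m := fun h => T.lt_irrefl m (h ▸ hk)
  let g : MvPolynomial (Fin 2) L := monomial m 1 - monomial k (u m / u k)
  have hdeg : LP T g = m := by
    have hlt : T.order.toSyn (T.order.degree (monomial k (u m / u k))) <
        T.order.toSyn (T.order.degree (monomial m (1 : L))) := by
      rw [T.order.degree_monomial (1 : L), if_neg one_ne_zero]
      exact (T.order.degree_monomial_le _).trans_lt hk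
    rw [LP, T.order.degree_sub_of_lt hlt, T.order.degree_monomial, if_neg one_ne_zero]
  have hg : g ≠ 0 := by
    intro h0
    have := congrArg (coeff m) h0
    simp [g, coeff_monomial, hkm] at this
  refine hno g hg hdeg fun n hn hnl => ?_
  rw [hdeg] at hn
  obtain rfl := honly n hn hnl
  rw [recVal_eq_shiftVal hdeg.le, hdeg, tsub_self]
  have hsub : g.support ⊆ {n, k} := by
    intro j hj
    by_contra hj'
    simp only [Finset.mem_insert, Finset.mem_singleton, not_or] at hj'
    refine mem_support_iff.mp hj ?_
    simp [g, coeff_monomial, Ne.symm hj'.1, Ne.symm hj'.2]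
  have hext : shiftVal u g 0 = ∑ j ∈ {n, k}, g.coeff j * u (j + 0) :=
    Finset.sum_subset hsub fun j _ hj => by rw [notMem_support_iff.mp hj, zero_mul]
  rw [hext, Finset.sum_pair hkm.symm]
  simp [g, coeff_monomial, hkm, hkm.symm, hne]

/-- A nonzero constant generates only the zero table. -/
lemma eq_zero_of_generates_of_LP_eq_zero {f : MvPolynomial (Fin 2) L} (hf : f ≠ 0)
    (h0 : LP T f = 0) (hgen : Generates T u l f) {k : Idx} (hk : T.lt k l) : u k = 0 := by
  have h := hgen k (by simp [h0]) hk
  have hc : f.coeff 0 ≠ 0 := by rw [← h0]; exact T.order.coeff_degree_ne_zero_iff.mpr hf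
  have hC : f = monomial 0 (T.order.leadingCoeff f) := T.order.eq_C_of_degree_eq_zero h0
  have hs : f.support = {0} := by
    classical
    rw [hC, support_monomial, if_neg (T.order.leadingCoeff_ne_zero_iff.mpr hf)]
  rw [recVal_eq_shiftVal (by simp [h0]), h0, shiftVal, hs] at h
  simpa [hc] using h

end Pairing

/-! ### Staircases in a box -/

/-- `(a 1, b 1), …, (a d, b d)` are the corners of a staircase that descends from the first axis
to the second one: the first coordinates decrease to `0` and the second ones increase from `0`. -/
structure Staircase (d : ℕ) (a b : ℕ → ℕ) : Prop where
  one_le : 1 ≤ d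
  fst_anti : ∀ i, 1 ≤ i → i < d → a (i + 1) < a i
  fst_last : a d = 0
  snd_first : b 1 = 0
  snd_mono : ∀ i, 1 ≤ i → i < d → b i < b (i + 1)

/-- Every point lies below the staircase or above one of its corners. -/
lemma Staircase.below_or_above {d : ℕ} {a b : ℕ → ℕ} (h : Staircase d a b) (x y : ℕ) :
    (∃ i, 1 ≤ i ∧ i < d ∧ x < a i ∧ y < b (i + 1)) ∨
      ∃ i, 1 ≤ i ∧ i ≤ d ∧ a i ≤ x ∧ b i ≤ y := by
  classical
  have hex : ∃ i, 1 ≤ i ∧ i ≤ d ∧ a i ≤ x := ⟨d, h.one_le, le_rfl, by simp [h.fst_last]⟩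
  -- The first corner whose abscissa is at most `x` decides.
  obtain ⟨h1, hd, ha⟩ := Nat.find_spec hex
  have hmin := fun j (hj : j < Nat.find hex) => Nat.find_min hex hj
  generalize Nat.find hex = i at *
  by_cases hb : b i ≤ y
  · exact Or.inr ⟨i, h1, hd, ha, hb⟩
  · obtain ⟨j, rfl⟩ : ∃ j, i = j + 1 := ⟨i - 1, by omega⟩
    have hj : 1 ≤ j := by
      rcases Nat.eq_zero_or_pos j with rfl | hj
      · exact absurd (h.snd_first.le.trans y.zero_le) hb
      · exact hj
    refine Or.inl ⟨j, hj, hd, ?_, not_le.mp hb⟩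
    by_contra hx
    exact hmin j j.lt_succ_self ⟨hj, by omega, not_lt.mp hx⟩

/-- A lower set `P` of the box `[0, A] × [0, B]` that contains at most one point of each pair
`p`, `(A, B) - p`, together with a staircase whose region lies in `P` and whose corners inside the
box are reflected into `P`. -/
structure ReflectedStaircase (P : ℕ → ℕ → Prop) (A B d : ℕ) (a b : ℕ → ℕ) : Prop
    extends Staircase d a b where
  lower : ∀ {x y x' y'}, x' ≤ x → y' ≤ y → P x y → P x' y'
  below : ∀ {i x y}, 1 ≤ i → i < d → x < a i → y < b (i + 1) → P x y
  corner : ∀ {i}, 1 ≤ i → i ≤ d → a i ≤ A → b i ≤ B → P (A - a i) (B - b i)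
  box : ∀ {x y}, P x y → x ≤ A ∧ y ≤ B
  not_reflect : ∀ {x y}, P x y → ¬ P (A - x) (B - y)

/-- Exchange of the two coordinates, which reverses the order of the corners. -/
lemma ReflectedStaircase.swap {P : ℕ → ℕ → Prop} {A B d : ℕ} {a b : ℕ → ℕ}
    (h : ReflectedStaircase P A B d a b) :
    ReflectedStaircase (fun x y => P y x) B A d (fun i => b (d + 1 - i))
      (fun i => a (d + 1 - i)) where
  one_le := h.one_le
  fst_anti i hi hd := by
    have := h.snd_mono (d - i) (by omega) (by omega)
    rwa [show d + 1 - (i + 1) = d - i by omega, show d + 1 - i = d - i + 1 by omega]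
  fst_last := by rw [show d + 1 - d = 1 by omega, h.snd_first]
  snd_first := by rw [show d + 1 - 1 = d by omega, h.fst_last]
  snd_mono i hi hd := by
    have := h.fst_anti (d - i) (by omega) (by omega)
    rwa [show d + 1 - (i + 1) = d - i by omega, show d + 1 - i = d - i + 1 by omega]
  lower hx hy := h.lower hy hx
  below {i x y} hi hd hx hy := by
    refine h.below (i := d - i) (by omega) (by omega) ?_ ?_
    · rwa [show d + 1 - (i + 1) = d - i by omega] at hy
    · rwa [show d + 1 - i = d - i + 1 by omega] at hx
  corner hi hd ha hb := h.corner (by omega) (by omega) hb ha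
  box hP := (h.box hP).symm
  not_reflect := h.not_reflect

/-- The reflected staircases in a box of width two. -/
lemma ReflectedStaircase.classification {P : ℕ → ℕ → Prop} {t d : ℕ} {a b : ℕ → ℕ} (ht : 2 ≤ t)
    (h : ReflectedStaircase P 1 (t - 1) d a b) :
    (d = 1 ∧ a 1 = 0) ∨ (d = 2 ∧ a 1 = 1 ∧ b 2 = t) ∨ (d = 2 ∧ a 1 = 2 ∧ t = 2 * b 2) ∨
      (d = 3 ∧ a 1 = 2 ∧ t = b 2 + b 3) := by
  have hd := h.one_le
  have hlast := h.fst_last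
  have hfirst := h.snd_first
  rcases hd.eq_or_lt with rfl | hd1
  · exact Or.inl ⟨rfl, hlast⟩
  have ha1 := h.fst_anti 1 le_rfl hd1
  have hb1 := h.snd_mono 1 le_rfl hd1
  norm_num [hfirst] at ha1 hb1
  have ha1le : a 1 ≤ 2 := by
    have := (h.box (h.below (x := a 1 - 1) (y := 0) le_rfl hd1 (by omega) hb1)).1
    omega
  have hb2 : P (a 1 - 1) (b 2 - 1) := h.below le_rfl hd1 (by omega) (by norm_num; omega)
  have hb2box := (h.box hb2).2
  rcases (show 2 ≤ d from hd1).eq_or_lt with rfl | hd2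
  · rcases (show a 1 = 1 ∨ a 1 = 2 by omega) with ha | ha
    · refine Or.inr (Or.inl ⟨rfl, ha, ?_⟩)
      have hcol := h.corner le_rfl hd (by omega) (by omega)
      rw [ha, hfirst] at hcol
      by_contra hne
      have hcor := h.corner (i := 2) (by norm_num) le_rfl (by omega) (by omega)
      rw [hlast] at hcor
      exact h.not_reflect (h.lower (x' := 1) (y' := 0) le_rfl (Nat.zero_le _) hcor) hcol
    · refine Or.inr (Or.inr (Or.inl ⟨rfl, ha, ?_⟩))
      rw [ha] at hb2
      have hup : ¬ t - b 2 ≤ b 2 - 1 := fun hle => h.not_reflect hb2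
        (h.lower (by norm_num) (by omega) hb2)
      have hcor := h.corner (i := 2) (by norm_num) le_rfl (by omega) (by omega)
      rw [hlast] at hcor
      have hlow : ¬ b 2 ≤ t - 1 - b 2 := fun hle => h.not_reflect hcor
        (h.lower (by norm_num) (by omega) hcor)
      omega
  · have ha2 := h.fst_anti 2 (by norm_num) hd2
    have hb2' := h.snd_mono 2 (by norm_num) hd2
    norm_num at ha2 hb2'
    obtain rfl : d = 3 := by
      by_contra hne
      have := h.fst_anti 3 (by norm_num) (by omega)
      norm_num at this
      omega
    have ha : a 1 = 2 := by omega
    refine Or.inr (Or.inr (Or.inr ⟨rfl, ha, ?_⟩))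
    rw [ha] at hb2
    have hb3 : P 0 (b 3 - 1) := h.below (i := 2) (by norm_num) hd2 (by omega) (by norm_num; omega)
    have hb3box := (h.box hb3).2
    have hup : ¬ t - b 2 ≤ b 3 - 1 := fun hle => h.not_reflect hb2
      (h.lower (by norm_num) (by omega) hb3)
    have hcor2 := h.corner (i := 2) (by norm_num) (by norm_num) (by omega) (by omega)
    have hcor3 := h.corner (i := 3) (by norm_num) le_rfl (by omega) (by omega)
    rw [hlast] at hcor3
    have hlow : ¬ b 3 ≤ t - 1 - b 2 := fun hle => h.not_reflect hcor3
      (h.lower (by norm_num) (by omega) hcor2)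
    omega

/-- If a set of at most half the size of a box contains a point of each pair `p`, `(A, B) - p`,
then it lies in the box and contains exactly one point of each pair. -/
lemma box_and_not_reflect {P : ℕ → ℕ → Prop} {A B t : ℕ} (hAB : (A + 1) * (B + 1) = 2 * t)
    (hcard : ∀ S : Finset (ℕ × ℕ), (∀ p ∈ S, P p.1 p.2) → S.card ≤ t)
    (hor : ∀ x y, x ≤ A → y ≤ B → P x y ∨ P (A - x) (B - y)) :
    (∀ x y, P x y → x ≤ A ∧ y ≤ B) ∧ ∀ x y, P x y → ¬ P (A - x) (B - y) := by
  classical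
  let R := Finset.range (A + 1) ×ˢ Finset.range (B + 1)
  have hR (p : ℕ × ℕ) : p ∈ R ↔ p.1 ≤ A ∧ p.2 ≤ B := by simp [R]
  let D := R.filter fun p => P p.1 p.2
  let N := R.filter fun p => ¬ P p.1 p.2
  let r : ℕ × ℕ → ℕ × ℕ := fun p => (A - p.1, B - p.2)
  have hDt : D.card ≤ t := hcard D fun p hp => (Finset.mem_filter.mp hp).2
  have hsum : D.card + N.card = 2 * t := by
    rw [Finset.card_filter_add_card_filter_not]
    simp [R, hAB]
  have hsub : N.image r ⊆ D := by
    intro q hq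
    obtain ⟨p, hp, rfl⟩ := Finset.mem_image.mp hq
    obtain ⟨hpR, hpP⟩ := Finset.mem_filter.mp hp
    rw [hR] at hpR
    exact Finset.mem_filter.mpr ⟨(hR _).mpr ⟨Nat.sub_le _ _, Nat.sub_le _ _⟩,
      (hor _ _ hpR.1 hpR.2).resolve_left hpP⟩
  have hinj : (N.image r).card = N.card := by
    refine Finset.card_image_of_injOn fun p hp q hq hpq => ?_
    have hp' := (hR p).mp (Finset.mem_filter.mp hp).1
    have hq' := (hR q).mp (Finset.mem_filter.mp hq).1
    simp only [r, Prod.mk.injEq] at hpq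
    ext <;> omega
  have hND := Finset.card_le_card hsub
  have himage : N.image r = D := Finset.eq_of_subset_of_card_le hsub (by omega)
  have hbox : ∀ x y, P x y → x ≤ A ∧ y ≤ B := by
    intro x y hxy
    by_contra hout
    have hnot : (x, y) ∉ D := fun hD => hout ((hR _).mp (Finset.mem_filter.mp hD).1)
    have := hcard (insert (x, y) D) fun p hp => by
      rcases Finset.mem_insert.mp hp with rfl | hp
      · exact hxy
      · exact (Finset.mem_filter.mp hp).2
    rw [Finset.card_insert_of_notMem hnot] at this
    omega
  refine ⟨hbox, fun x y hxy hrefl => ?_⟩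
  have hD : (x, y) ∈ D := Finset.mem_filter.mpr ⟨(hR _).mpr (hbox x y hxy), hxy⟩
  obtain ⟨p, hp, hpe⟩ := Finset.mem_image.mp (himage ▸ hD)
  obtain ⟨hpR, hpP⟩ := Finset.mem_filter.mp hp
  rw [hR] at hpR
  simp only [r, Prod.mk.injEq] at hpe
  apply hpP
  rwa [← hpe.1, ← hpe.2, Nat.sub_sub_self hpR.1, Nat.sub_sub_self hpR.2] at hrefl

/-! ### Minimal sets none of whose members extends -/

section Minimal

variable {L : Type*} [Field L] {T : TermOrder} {u : Idx → L} {d : ℕ}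
  {f : ℕ → MvPolynomial (Fin 2) L}

lemma IsMinimalSet.staircase {l : Idx} (h : IsMinimalSet T u l d f) :
    Staircase d (fun i => LP T (f i) 0) (fun i => LP T (f i) 1) :=
  ⟨h.one_le, h.fst_anti, h.fst_last, h.snd_first, h.snd_mono⟩

lemma IsMinimalSet.footprint_subset {l : Idx} (h : IsMinimalSet T u l d f) :
    footprint d (fun i => LP T (f i)) ⊆ deltaSet T u := by
  rintro n ⟨i, hi, hd, h0, h1⟩ g hg ha hle
  rw [le_iff_coords] at hle
  exact h.minimal g hg ⟨i, hi, hd, hle.1.trans_lt h0, hle.2.trans_lt h1⟩ ha.generates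

/-- When no member of a minimal set for `u^l` extends to `l` and the rectangle below `l` has at
least twice as many points as the footprint of `u`, that footprint is half of the rectangle. -/
lemma IsMinimalSet.reflectedStaircase {A B t : ℕ} (hAB : (A + 1) * (B + 1) = 2 * t)
    (h : IsMinimalSet T u (idx A B) d f)
    (hcard : ∀ S : Finset Idx, (∀ n ∈ S, n ∈ deltaSet T u) → S.card ≤ t)
    (hno : ∀ i, 1 ≤ i → i ≤ d → LP T (f i) ≤ idx A B → recVal T u (f i) (idx A B) ≠ 0) :
    ReflectedStaircase (fun x y => idx x y ∈ deltaSet T u) A B d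
      (fun i => LP T (f i) 0) (fun i => LP T (f i) 1) := by
  have hlower : ∀ {x y x' y'}, x' ≤ x → y' ≤ y → idx x y ∈ deltaSet T u →
      idx x' y' ∈ deltaSet T u := fun hx hy =>
    mem_deltaSet_of_le (le_iff_coords.mpr ⟨by simpa using hx, by simpa using hy⟩)
  have hbelow : ∀ {i x y}, 1 ≤ i → i < d → x < LP T (f i) 0 → y < LP T (f (i + 1)) 1 →
      idx x y ∈ deltaSet T u := fun {i x y} hi hd hx hy =>
    h.footprint_subset ⟨i, hi, hd, by simpa using hx, by simpa using hy⟩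
  have hcorner : ∀ {i}, 1 ≤ i → i ≤ d → LP T (f i) 0 ≤ A → LP T (f i) 1 ≤ B →
      idx (A - LP T (f i) 0) (B - LP T (f i) 1) ∈ deltaSet T u := by
    intro i hi hd h0 h1
    have hle : LP T (f i) ≤ idx A B := le_iff_coords.mpr ⟨by simpa using h0, by simpa using h1⟩
    have := sub_mem_deltaSet (h.generates i hi hd) hle (hno i hi hd hle)
    rwa [← idx_eta (LP T (f i)), idx_sub] at this
  have hor : ∀ x y, x ≤ A → y ≤ B →
      idx x y ∈ deltaSet T u ∨ idx (A - x) (B - y) ∈ deltaSet T u := by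
    intro x y hx hy
    rcases h.staircase.below_or_above x y with ⟨i, hi, hd, h0, h1⟩ | ⟨i, hi, hd, h0, h1⟩
    · exact Or.inl (hbelow hi hd h0 h1)
    · exact Or.inr (hlower (by omega) (by omega) (hcorner hi hd (h0.trans hx) (h1.trans hy)))
  have hcard' : ∀ S : Finset (ℕ × ℕ), (∀ p ∈ S, idx p.1 p.2 ∈ deltaSet T u) → S.card ≤ t := by
    classical
    intro S hS
    have hinj : Function.Injective fun p : ℕ × ℕ => idx p.1 p.2 := fun p q hpq => by
      have h0 := DFunLike.congr_fun hpq 0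
      have h1 := DFunLike.congr_fun hpq 1
      simp only [idx_apply_zero, idx_apply_one] at h0 h1
      exact Prod.ext h0 h1
    rw [← Finset.card_image_of_injective S hinj]
    refine hcard _ fun n hn => ?_
    obtain ⟨p, hp, rfl⟩ := Finset.mem_image.mp hn
    exact hS p hp
  obtain ⟨hbox, hrefl⟩ := box_and_not_reflect hAB hcard' hor
  exact { h.staircase with
    lower := hlower
    below := hbelow
    corner := hcorner
    box := fun {x y} => hbox x y
    not_reflect := fun {x y} => hrefl x y }

/-- The exponent `m` lies in the footprint of the minimal set, so that the table vanishes before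
`m` if `m` is the only index below `l` that bears on polynomials with leading exponent `m`. -/
lemma IsMinimalSet.eq_zero_of_lt {l m k : Idx} (h : IsMinimalSet T u l d f)
    (hm : m ∈ footprint d (fun i => LP T (f i)))
    (honly : ∀ k, m ≤ k → T.lt k l → k = m) (hk : T.lt k m) : u k = 0 :=
  eq_zero_of_forall_not_generates honly (fun g hg hgm => h.minimal g hg (hgm ▸ hm)) hk

end Minimal

/-! ### The syndrome table -/

lemma syndromeTable_eq_sum {F L : Type*} [Field F] [Field L] [Algebra F L] (α₁ α₂ : L) (τ : Idx)
    (e : MvPolynomial (Fin 2) F) (n : Idx) :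
    syndromeTable α₁ α₂ τ e n = ∑ m ∈ e.support,
      (algebraMap F L (e.coeff m) * α₁ ^ (τ 0 * m 0) * α₂ ^ (τ 1 * m 1)) *
        (α₁ ^ m 0) ^ n 0 * (α₂ ^ m 1) ^ n 1 := by
  rw [syndromeTable, aeval_def, eval₂_eq']
  refine Finset.sum_congr rfl fun m _ => ?_
  simp only [Fin.prod_univ_two, Matrix.cons_val_zero, Matrix.cons_val_one]
  ring

/-- The initial condition provides a nonzero entry before every index of positive abscissa and
of total degree at least `2`. -/
lemma InitialCondition.exists_lt {L : Type*} [Field L] {T : TermOrder} {t A B : ℕ} {u : Idx → L}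
    (h : InitialCondition T t u) (hA : 1 ≤ A) (hAB : 2 ≤ A + B) :
    ∃ k, T.lt k (idx A B) ∧ u k ≠ 0 := by
  cases T with
  | lex =>
    obtain ⟨j, -, hj⟩ := h
    exact ⟨_, lex_lt_coords.mpr (Or.inl (by simp; omega)), hj⟩
  | graded =>
    obtain ⟨i, j, hij, hu⟩ := h
    exact ⟨_, graded_lt_coords.mpr (Or.inl (by simp; omega)), hu⟩

/-! ### Existence of an extending polynomial -/

theorem mainTheorem2 {F L : Type*} [Field F] [Fintype F] [Field L] [Algebra F L]
    (r₁ r₂ t : ℕ) (hq : Nat.Coprime (Fintype.card F) (r₁ * r₂))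
    (α₁ α₂ : L) (hα₁ : α₁ ^ r₁ = 1) (hα₂ : α₂ ^ r₂ = 1)
    (e : MvPolynomial (Fin 2) F) (he : IsCanonical r₁ r₂ e)
    (hw : e.support.card ≤ t) (ht₁ : t ≤ r₁ / 2) (ht₂ : t ≤ r₂ / 2)
    (τ : Idx) (hτ₁ : τ 0 < r₁) (hτ₂ : τ 1 < r₂)
    (U : Idx → L) (hU : U = syndromeTable α₁ α₂ τ e)
    (T : TermOrder) (hT : InitialCondition T t U)
    (d : ℕ) (f : ℕ → MvPolynomial (Fin 2) L) (s : ℕ → Idx) (hs : ∀ i, s i = LP T (f i)) :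
    (2 ≤ t → IsMinimalSet T U (idx 1 (t - 1)) d f →
      ¬ (d = 2 ∧ s 1 0 = 1 ∧ s 2 1 = t ∧
          (T = TermOrder.lex ∨
            (T = TermOrder.graded ∧ t = 2 ∧ U (idx 0 0) = 0 ∧ U (idx 1 0) = 0))) →
      ¬ (d = 2 ∧ s 1 = idx 2 0 ∧ t = 2 * s 2 1 ∧
          (T = TermOrder.lex → idx 1 (t - 1) ≠ idx 1 1)) →
      ¬ (d = 3 ∧ s 1 = idx 2 0 ∧ t = s 2 1 + s 3 1) →
      ∃ i, 1 ≤ i ∧ i ≤ d ∧ s i ≤ idx 1 (t - 1) ∧ recVal T U (f i) (idx 1 (t - 1)) = 0) ∧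
    (2 < t → IsMinimalSet T U (idx (t - 1) 1) d f →
      ¬ (d = 2 ∧ s 1 0 = t ∧ s 2 1 = 1 ∧ T = TermOrder.graded) →
      ¬ (d = 2 ∧ s 2 = idx 0 2 ∧ t = 2 * s 1 0) →
      ¬ (d = 3 ∧ s 3 = idx 0 2 ∧ t = s 1 0 + s 2 0) →
      ∃ i, 1 ≤ i ∧ i ≤ d ∧ s i ≤ idx (t - 1) 1 ∧ recVal T U (f i) (idx (t - 1) 1) = 0) := by
  have hcard : ∀ S : Finset Idx, (∀ n ∈ S, n ∈ deltaSet T U) → S.card ≤ t := fun S hS =>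
    (card_le_of_subset_deltaSet e.support _ _ _
      (fun n => by rw [hU]; exact syndromeTable_eq_sum α₁ α₂ τ e n) S hS).trans hw
  simp only [hs]
  constructor
  · intro ht hmin hexA hexB hexC
    by_contra! hno
    obtain ⟨k, hk, hUk⟩ := hT.exists_lt (A := 1) (B := t - 1) le_rfl (by omega)
    have hfirst := hmin.snd_first
    rcases (hmin.reflectedStaircase (by omega) hcard hno).classification ht with
      ⟨rfl, h1⟩ | ⟨rfl, h1, h2⟩ | ⟨rfl, h1, h2⟩ | ⟨rfl, h1, h2⟩
    · refine hUk (eq_zero_of_generates_of_LP_eq_zero (hmin.ne_zero 1 le_rfl le_rfl) ?_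
        (hmin.generates 1 le_rfl le_rfl) hk)
      ext i; fin_cases i <;> simpa
    · refine hexA ⟨rfl, h1, h2, ?_⟩
      cases T with
      | lex => exact Or.inl rfl
      | graded =>
        -- A polynomial with leading exponent `(0, t - 1)` is tested at `(0, t - 1)` alone.
        have hzero : ∀ {k}, TermOrder.graded.lt k (idx 0 (t - 1)) → U k = 0 := fun {k} =>
          hmin.eq_zero_of_lt ⟨1, le_rfl, by norm_num, by simp [h1], by simp [h2]; omega⟩
            (fun k hle hlt => by
              rw [le_iff_coords] at hle
              rw [graded_lt_coords] at hlt
              simp only [idx_apply_zero, idx_apply_one] at hle hlt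
              rw [← idx_eta k, show k 0 = 0 by omega, show k 1 = t - 1 by omega])
        have ht2 : t = 2 := by
          obtain ⟨i, j, hij, hu⟩ := hT
          by_contra hne
          exact hu (hzero (graded_lt_coords.mpr (Or.inl (by simp; omega))))
        exact Or.inr ⟨rfl, ht2, hzero (graded_lt_coords.mpr (by simp [ht2])),
          hzero (graded_lt_coords.mpr (by simp [ht2]))⟩
    · refine hexB ⟨rfl, ?_, h2, fun hlex hl => ?_⟩
      · rw [← idx_eta (LP T (f 1)), h1, hfirst]
      · subst hlex
        have hl1 := DFunLike.congr_fun hl 1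
        simp only [idx_apply_one] at hl1
        obtain ⟨j, -, hj⟩ := hT
        -- A polynomial with leading exponent `(1, 0)` is tested at `(1, 0)` alone.
        refine hj (hmin.eq_zero_of_lt (m := idx 1 0)
          ⟨1, le_rfl, by norm_num, by simp [h1], by simp; omega⟩ (fun k hle hlt => ?_)
          (lex_lt_coords.mpr (Or.inl (by simp))))
        rw [le_iff_coords] at hle
        rw [lex_lt_coords] at hlt
        simp only [idx_apply_zero, idx_apply_one] at hle hlt
        rw [← idx_eta k, show k 0 = 1 by omega, show k 1 = 0 by omega]
    · exact hexC ⟨rfl, by rw [← idx_eta (LP T (f 1)), h1, hfirst], h2⟩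
  · intro ht hmin hexA hexB hexC
    by_contra! hno
    obtain ⟨k, hk, hUk⟩ := hT.exists_lt (A := t - 1) (B := 1) (by omega) (by omega)
    have hlast := hmin.fst_last
    rcases (hmin.reflectedStaircase (by omega) hcard hno).swap.classification ht.le with
      ⟨rfl, h1⟩ | ⟨rfl, h1, h2⟩ | ⟨rfl, h1, h2⟩ | ⟨rfl, h1, h2⟩
    · refine hUk (eq_zero_of_generates_of_LP_eq_zero (hmin.ne_zero 1 le_rfl le_rfl) ?_
        (hmin.generates 1 le_rfl le_rfl) hk)
      ext i; fin_cases i <;> simpa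
    · norm_num at h1 h2
      cases T with
      | lex =>
        obtain ⟨j, -, hj⟩ := hT
        -- A polynomial with leading exponent `(t - 1, 0)` is tested at `(t - 1, 0)` alone.
        refine hj (hmin.eq_zero_of_lt (m := idx (t - 1) 0)
          ⟨1, le_rfl, by norm_num, by simp [h2]; omega, by simp [h1]⟩ (fun k hle hlt => ?_)
          (lex_lt_coords.mpr (Or.inl (by simp; omega))))
        rw [le_iff_coords] at hle
        rw [lex_lt_coords] at hlt
        simp only [idx_apply_zero, idx_apply_one] at hle hlt
        rw [← idx_eta k, show k 0 = t - 1 by omega, show k 1 = 0 by omega]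
      | graded => exact hexA ⟨rfl, h2, h1, rfl⟩
    · norm_num at h1 h2
      exact hexB ⟨rfl, by rw [← idx_eta (LP T (f 2)), h1, hlast], h2⟩
    · norm_num at h1 h2
      exact hexC ⟨rfl, by rw [← idx_eta (LP T (f 3)), h1, hlast], by omega⟩
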